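/- Let $\mathbb{D}$ be the open unit disc in $\mathbb{C}$ with the normalized area measure $dA=\frac1\pi\,dx\,dy$, and let $A^2$ be the Bergman space, i.e. the closed subspace of $L^2(\mathbb{D},dA)$ consisting of analytic functions. For $\varphi\in L^\infty(\mathbb{D})$ let $T_\varphi\colon A^2\to A^2$, $T_\varphi f=P(\varphi f)$, be the Toeplitz operator with symbol $\varphi$, where $P$ is the orthogonal projection of $L^2(\mathbb{D},dA)$ onto $A^2$. For $g\in L^\infty(\mathbb{D})$ let $$B(g)(z)=\int_{\mathbb{D}}|k_z(w)|^2\,g(w)\,dA(w),\qquad k_z(w)=\frac{1-|z|^2}{(1-w\bar z)^2},\qquad z\in\mathbb{D},$$ be the Berezin transform of $g$. **Theorem 3.1.** Let $\varphi\colon\mathbb{D}\to\mathbb{C}$ be a bounded (Lebesgue) measurable function such that $$\operatorname{Re}\varphi(z)\ \ge\ |\operatorname{Im}\varphi(z)|^2\qquad\text{for all } z\in\mathbb{D}.$$ Then the Toeplitz operator $T_\varphi$ is invertible on $A^2$ (has a bounded inverse) if and only if the Berezin transform $B(|\varphi|)$ is invertible in the algebra $L^\infty(\mathbb{D})$. 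-/

import Mathlib

noncomputable section

namespace BergmanToeplitz

open MeasureTheory Filter Topology Metric
open scoped ENNReal

/-- The normalized area measure `dA = (1/π) dx dy` on the open unit disc, as a measure on `ℂ`. -/
def areaMeasure : Measure ℂ :=
  (ENNReal.ofReal Real.pi)⁻¹ • (volume.restrict (ball (0 : ℂ) 1))

theorem ofReal_pi_ne_zero : ENNReal.ofReal Real.pi ≠ 0 := by
  simpa using Real.pi_pos

theorem areaMeasure_univ : areaMeasure Set.univ = 1 := by
  have h : (ENNReal.ofReal Real.pi) = (NNReal.pi : ℝ≥0∞) := by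
    rw [ENNReal.ofReal, ← NNReal.coe_real_pi, Real.toNNReal_coe]
  have h2 := ofReal_pi_ne_zero
  simp only [areaMeasure, Measure.smul_apply, Measure.restrict_apply MeasurableSet.univ,
    Set.univ_inter, Complex.volume_ball, smul_eq_mul]
  rw [h] at h2 ⊢
  simpa using ENNReal.inv_mul_cancel h2 ENNReal.coe_ne_top

instance : IsProbabilityMeasure areaMeasure := ⟨areaMeasure_univ⟩

theorem ae_areaMeasure_mem : ∀ᵐ z ∂areaMeasure, z ∈ ball (0 : ℂ) 1 :=
  Measure.ae_smul_measure (ae_restrict_mem measurableSet_ball) _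

/-- The Hilbert space `L²(𝔻)` with respect to the normalized area measure. -/
abbrev L2 : Type := Lp ℂ 2 areaMeasure

/-- The Bergman space `A²(𝔻)`: the subspace of those elements of `L²(𝔻)` that are represented by
a function holomorphic in the open unit disc. -/
def bergmanSpace : Submodule ℂ L2 where
  carrier := {f | ∃ g : ℂ → ℂ, DifferentiableOn ℂ g (ball 0 1) ∧ f =ᵐ[areaMeasure] g}
  zero_mem' := ⟨0, differentiableOn_const 0, Lp.coeFn_zero ℂ 2 areaMeasure⟩
  add_mem' := by
    rintro a b ⟨g, hg, hag⟩ ⟨h, hh, hbh⟩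
    exact ⟨g + h, hg.add hh, (Lp.coeFn_add a b).trans (hag.add hbh)⟩
  smul_mem' := by
    rintro c a ⟨g, hg, hag⟩
    exact ⟨c • g, hg.const_smul c, (Lp.coeFn_smul c a).trans (hag.const_smul c)⟩

/-- Rotation averaging: the area form of the mean value inequality. -/
theorem enorm_mul_volume_le {g : ℂ → ℂ} {z : ℂ} {r : ℝ}
    (hg : DifferentiableOn ℂ g (ball z r)) :
    ‖g z‖ₑ * volume (ball (0 : ℂ) r) ≤ ∫⁻ w in ball z r, ‖g w‖ₑ := by
  set S : Set ℝ := Set.Ioc 0 (2 * Real.pi) with hS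
  have hSvol : volume S = ENNReal.ofReal (2 * Real.pi) := by simp [hS]
  have hmem : ∀ (w : ℂ), w ∈ ball (0 : ℂ) r → ∀ u : ℂ, ‖u‖ ≤ 1 → z + u * w ∈ ball z r := by
    intro w hw u hu
    rw [mem_ball_zero_iff] at hw
    rw [mem_ball, dist_eq_norm, add_sub_cancel_left, norm_mul]
    nlinarith [norm_nonneg w, norm_nonneg u]
  have htrans : ∫⁻ w in ball z r, ‖g w‖ₑ = ∫⁻ w in ball (0 : ℂ) r, ‖g (z + w)‖ₑ := by
    have hp : MeasurePreserving (fun w : ℂ => z + w) volume volume :=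
      measurePreserving_add_left volume z
    rw [← hp.setLIntegral_comp_preimage_emb (MeasurableEquiv.addLeft z).measurableEmbedding]
    congr 2
    ext w
    simp [dist_eq_norm]
  have hrot : ∀ θ : ℝ, ∫⁻ w in ball (0 : ℂ) r, ‖g (z + circleMap 0 1 θ * w)‖ₑ
      = ∫⁻ w in ball (0 : ℂ) r, ‖g (z + w)‖ₑ := by
    intro θ
    have hp : MeasurePreserving (rotation (Circle.exp θ)) volume volume :=
      (rotation (Circle.exp θ)).measurePreserving
    have he : MeasurableEmbedding (rotation (Circle.exp θ)) :=
      (rotation (Circle.exp θ)).toHomeomorph.measurableEmbedding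
    rw [← hp.setLIntegral_comp_preimage_emb he (fun w => ‖g (z + w)‖ₑ)]
    have : (rotation (Circle.exp θ)) ⁻¹' ball (0 : ℂ) r = ball 0 r := by
      ext w; simp only [Set.mem_preimage, mem_ball_zero_iff, LinearIsometryEquiv.norm_map]
    rw [this]
    simp [circleMap, rotation_apply]
  have hswap : ∫⁻ θ in S, ∫⁻ w in ball (0 : ℂ) r, ‖g (z + circleMap 0 1 θ * w)‖ₑ
      = ∫⁻ w in ball (0 : ℂ) r, ∫⁻ θ in S, ‖g (z + circleMap 0 1 θ * w)‖ₑ := by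
    apply lintegral_lintegral_swap
    rw [Measure.prod_restrict]
    have hc : ContinuousOn (fun p : ℝ × ℂ => g (z + circleMap 0 1 p.1 * p.2))
        (S ×ˢ ball (0 : ℂ) r) := by
      apply hg.continuousOn.comp
      · have : Continuous (fun p : ℝ × ℂ => z + circleMap 0 1 p.1 * p.2) := by
          have := continuous_circleMap 0 1
          fun_prop
        exact this.continuousOn
      · rintro ⟨θ, w⟩ ⟨-, hw⟩
        exact hmem w hw _ (by simp)
    exact (hc.enorm).aemeasurable (measurableSet_Ioc.prod measurableSet_ball)
  have hinner : ∀ w ∈ ball (0 : ℂ) r, ‖g z‖ₑ * volume S ≤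
      ∫⁻ θ in S, ‖g (z + circleMap 0 1 θ * w)‖ₑ := by
    intro w hw
    have hd : DiffContOnCl ℂ (fun u : ℂ => g (z + u * w)) (ball 0 |1|) := by
      have : DifferentiableOn ℂ (fun u : ℂ => g (z + u * w)) (closedBall 0 1) := by
        apply hg.comp (by fun_prop)
        intro u hu
        exact hmem w hw u (by simpa using hu)
      rw [abs_one]
      exact this.diffContOnCl_ball subset_rfl
    have hm := hd.circleAverage
    rw [Real.circleAverage_def, intervalIntegral.integral_of_le (by positivity)] at hm
    have h2 : ‖∫ θ in S, g (z + circleMap 0 1 θ * w)‖ₑ ≤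
      ∫⁻ θ in S, ‖g (z + circleMap 0 1 θ * w)‖ₑ := enorm_integral_le_lintegral_enorm _
    refine le_trans (le_of_eq ?_) h2
    have h3 : ∫ θ in S, g (z + circleMap 0 1 θ * w) = (2 * Real.pi) • g z := by
      have h4 : (2 * Real.pi) ≠ 0 := by positivity
      rw [← smul_right_injective ℂ (inv_ne_zero h4) |>.eq_iff]
      simp only [zero_mul, add_zero] at hm
      rw [hm, smul_smul, inv_mul_cancel₀ h4, one_smul]
    rw [h3, enorm_smul, hSvol, mul_comm, Real.enorm_of_nonneg (by positivity)]
  have key : (‖g z‖ₑ * volume (ball (0 : ℂ) r)) * volume S ≤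
      (∫⁻ w in ball (0 : ℂ) r, ‖g (z + w)‖ₑ) * volume S := by
    calc (‖g z‖ₑ * volume (ball (0 : ℂ) r)) * volume S
        = ∫⁻ _ in ball (0 : ℂ) r, ‖g z‖ₑ * volume S := by
          rw [setLIntegral_const]; ring
      _ ≤ ∫⁻ w in ball (0 : ℂ) r, ∫⁻ θ in S, ‖g (z + circleMap 0 1 θ * w)‖ₑ :=
          setLIntegral_mono' measurableSet_ball hinner
      _ = (∫⁻ w in ball (0 : ℂ) r, ‖g (z + w)‖ₑ) * volume S := by
          rw [← hswap]; simp_rw [hrot]; rw [setLIntegral_const]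
  rw [htrans]
  refine (ENNReal.mul_le_mul_iff_left ?_ ?_).1 key
  · rw [hSvol]; simpa using Real.pi_pos
  · rw [hSvol]; exact ENNReal.ofReal_ne_top

/-- Point evaluations of holomorphic functions are bounded by the `L²(𝔻)` norm. -/
theorem enorm_mul_le_eLpNorm {g : ℂ → ℂ} (hg : DifferentiableOn ℂ g (ball 0 1))
    (hgm : AEStronglyMeasurable g areaMeasure) {z : ℂ} {r : ℝ} (hzr : ball z r ⊆ ball 0 1) :
    ‖g z‖ₑ * ENNReal.ofReal r ^ 2 ≤ eLpNorm g 2 areaMeasure := by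
  have h1 := enorm_mul_volume_le (hg.mono hzr)
  have h2 : ∫⁻ w in ball z r, ‖g w‖ₑ ≤ ∫⁻ w in ball 0 1, ‖g w‖ₑ := lintegral_mono_set hzr
  have h3 : eLpNorm g 1 areaMeasure ≤ eLpNorm g 2 areaMeasure :=
    eLpNorm_le_eLpNorm_of_exponent_le (by norm_num) hgm
  refine le_trans ?_ h3
  rw [eLpNorm_one_eq_lintegral_enorm, areaMeasure, lintegral_smul_measure, smul_eq_mul]
  have h4 := h1.trans h2
  rw [Complex.volume_ball] at h4
  have h : (ENNReal.ofReal Real.pi) = (NNReal.pi : ℝ≥0∞) := by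
    rw [ENNReal.ofReal, ← NNReal.coe_real_pi, Real.toNNReal_coe]
  rw [← h] at h4
  calc ‖g z‖ₑ * ENNReal.ofReal r ^ 2
      = (ENNReal.ofReal Real.pi)⁻¹ *
        (‖g z‖ₑ * (ENNReal.ofReal r ^ 2 * ENNReal.ofReal Real.pi)) := by
        rw [mul_comm (ENNReal.ofReal Real.pi)⁻¹, mul_assoc, mul_assoc,
          ENNReal.mul_inv_cancel ofReal_pi_ne_zero ENNReal.ofReal_ne_top, mul_one]
    _ ≤ _ := by gcongr

theorem isClosed_bergmanSpace : IsClosed (bergmanSpace : Set L2) := by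
  apply IsSeqClosed.isClosed
  intro f F hf hF
  choose g hg hfg using hf
  have hball : ∀ ρ : ℝ, ∀ z ∈ closedBall (0 : ℂ) ρ, ball z (1 - ρ) ⊆ ball 0 1 := by
    intro ρ z hz
    apply ball_subset_ball'
    rw [mem_closedBall] at hz
    linarith
  have hbound : ∀ ρ : ℝ, ρ < 1 → ∀ z ∈ closedBall (0 : ℂ) ρ, ∀ m n,
      ‖g m z - g n z‖ * (1 - ρ) ^ 2 ≤ ‖f m - f n‖ := by
    intro ρ hρ z hz m n
    have hae : (f m - f n : L2) =ᵐ[areaMeasure] g m - g n :=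
      (Lp.coeFn_sub _ _).trans ((hfg m).sub (hfg n))
    have h1 := enorm_mul_le_eLpNorm ((hg m).sub (hg n))
      ((Lp.aestronglyMeasurable (f m - f n)).congr hae) (hball ρ z hz)
    rw [← eLpNorm_congr_ae hae] at h1
    have h2 := ENNReal.toReal_mono (Lp.eLpNorm_ne_top (f m - f n)) h1
    rw [← Lp.norm_def, ENNReal.toReal_mul, ENNReal.toReal_pow,
      ENNReal.toReal_ofReal (by linarith), toReal_enorm] at h2
    exact h2
  have hcau : CauchySeq f := hF.cauchySeq
  have hucau : ∀ ρ : ℝ, ρ < 1 → UniformCauchySeqOn g atTop (closedBall (0 : ℂ) ρ) := by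
    intro ρ hρ
    rw [Metric.uniformCauchySeqOn_iff]
    intro ε hε
    have hpos : 0 < (1 - ρ) ^ 2 := by have : 0 < 1 - ρ := by linarith
                                      positivity
    obtain ⟨N, hN⟩ := Metric.cauchySeq_iff.1 hcau (ε * (1 - ρ) ^ 2) (by positivity)
    refine ⟨N, fun m hm n hn z hz => ?_⟩
    have h1 := hbound ρ hρ z hz m n
    have h2 := hN m hm n hn
    rw [dist_eq_norm] at h2 ⊢
    exact lt_of_mul_lt_mul_right (h1.trans_lt h2) hpos.le
  have hlim : ∀ z ∈ ball (0 : ℂ) 1, ∃ y, Tendsto (fun n => g n z) atTop (𝓝 y) := by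
    intro z hz
    rw [mem_ball_zero_iff] at hz
    exact cauchySeq_tendsto_of_complete ((hucau ‖z‖ hz).cauchySeq (by simp))
  classical
  let G : ℂ → ℂ := fun z => if hz : z ∈ ball (0 : ℂ) 1 then (hlim z hz).choose else 0
  have hG : ∀ z ∈ ball (0 : ℂ) 1, Tendsto (fun n => g n z) atTop (𝓝 (G z)) := by
    intro z hz
    simp only [G, dif_pos hz]
    exact (hlim z hz).choose_spec
  have hunif : TendstoLocallyUniformlyOn g G atTop (ball (0 : ℂ) 1) := by
    rw [tendstoLocallyUniformlyOn_iff_forall_isCompact isOpen_ball]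
    intro K hK hKc
    obtain ⟨ρ, hρ, hKρ⟩ : ∃ ρ < 1, K ⊆ closedBall (0 : ℂ) ρ := by
      rcases K.eq_empty_or_nonempty with rfl | hne
      · exact ⟨0, one_pos, Set.empty_subset _⟩
      · obtain ⟨w, hw, hmax⟩ := hKc.exists_isMaxOn hne continuous_norm.continuousOn
        refine ⟨‖w‖, by simpa using hK hw, fun z hz => ?_⟩
        simpa using hmax hz
    exact ((hucau ρ hρ).mono hKρ).tendstoUniformlyOn_of_tendsto fun z hz => hG z (hK hz)
  refine ⟨G, hunif.differentiableOn (Eventually.of_forall hg) isOpen_ball, ?_⟩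
  obtain ⟨ns, hns, hae⟩ := (tendstoInMeasure_of_tendsto_Lp hF).exists_seq_tendsto_ae
  filter_upwards [hae, ae_all_iff.2 hfg, ae_areaMeasure_mem] with z hz hz2 hz3
  refine tendsto_nhds_unique hz ?_
  simp_rw [hz2]
  exact (hG z hz3).comp hns.tendsto_atTop

instance : CompleteSpace bergmanSpace := isClosed_bergmanSpace.completeSpace_coe

/-- The Bergman projection: the orthogonal projection of `L²(𝔻)` onto `A²(𝔻)`. -/
def bergmanProjection : L2 →L[ℂ] bergmanSpace :=
  bergmanSpace.orthogonalProjectionOnto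

/-- The operator `M_φ : L²(𝔻) → L²(𝔻)`, `f ↦ φ f`, of multiplication by `φ ∈ L^∞(𝔻)`. -/
def mulOperator (φ : ℂ → ℂ) (hφ : MemLp φ ∞ areaMeasure) : L2 →L[ℂ] L2 :=
  (ContinuousLinearMap.mul ℂ ℂ).holderL areaMeasure ∞ 2 2 (hφ.toLp φ)

/-- `M_φ f` is indeed represented by the pointwise product. -/
theorem mulOperator_ae_eq (φ : ℂ → ℂ) (hφ : MemLp φ ∞ areaMeasure) (f : L2) :
    mulOperator φ hφ f =ᵐ[areaMeasure] fun z => φ z * f z := by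
  refine (ContinuousLinearMap.coeFn_holder (r := 2) (ContinuousLinearMap.mul ℂ ℂ)
    (hφ.toLp φ) f).trans ?_
  filter_upwards [hφ.coeFn_toLp] with z hz
  simp [hz]

/-- The Toeplitz operator `T_φ = P M_φ : A²(𝔻) → A²(𝔻)` with symbol `φ ∈ L^∞(𝔻)`. -/
def toeplitz (φ : ℂ → ℂ) (hφ : MemLp φ ∞ areaMeasure) : bergmanSpace →L[ℂ] bergmanSpace :=
  bergmanProjection ∘L mulOperator φ hφ ∘L bergmanSpace.subtypeL

/-- The normalized Bergman kernel `k_z(w) = (1 - |z|²) / (1 - w z̄)²`. -/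
def normalizedKernel (z w : ℂ) : ℂ :=
  (1 - (‖z‖ : ℂ) ^ 2) / (1 - w * (starRingEnd ℂ) z) ^ 2

/-- The Berezin transform `B(g)(z) = ∫_𝔻 |k_z(w)|² g(w) dA(w)` of a function `g ∈ L^∞(𝔻)`,
to be evaluated at points `z` of the unit disc. -/
def berezin (g : ℂ → ℂ) (z : ℂ) : ℂ :=
  ∫ w, (‖normalizedKernel z w‖ ^ 2 : ℝ) * g w ∂areaMeasure

/-- `g` represents an invertible element of the algebra `L^∞(𝔻)`: it belongs to `L^∞(𝔻)`, and so
does some `h` with `g h = 1` almost everywhere in the disc. -/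
def IsInvertibleInLinfty (g : ℂ → ℂ) : Prop :=
  MemLp g ∞ areaMeasure ∧
    ∃ h : ℂ → ℂ, MemLp h ∞ areaMeasure ∧ ∀ᵐ z ∂areaMeasure, g z * h z = 1

/-- A bounded measurable function on the disc belongs to `L^∞(𝔻)`. -/
theorem memLp_top_of_bounded {φ : ℂ → ℂ} (hm : AEMeasurable φ areaMeasure)
    (hb : ∃ C : ℝ, ∀ z ∈ ball (0 : ℂ) 1, ‖φ z‖ ≤ C) : MemLp φ ∞ areaMeasure := by
  obtain ⟨C, hC⟩ := hb
  exact memLp_top_of_bound hm.aestronglyMeasurable C (ae_areaMeasure_mem.mono hC)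

end BergmanToeplitz

end

/-! If `T_φ` is invertible, it is bounded below on the unit vectors `k_a`. Since `P` is a
contraction and `|φ|² ≤ C|φ|`, this gives `1 ≤ N²‖φ k_a‖² ≤ N² C B(|φ|)(a)`, a uniform lower bound
for the Berezin transform (`one_le_of_norm_le_toeplitz`).

Conversely, `|Im φ|² ≤ Re φ` and boundedness give `|φ|² ≤ (C + 1) Re φ`, so a lower bound on
`B(|φ|)` passes to `B(Re φ)` (`le_lintegral_normalizedKernel_mul_re`). Luecking's inequality
`exists_lintegral_enorm_sq_le` with weight `Re φ` then bounds `‖f‖²` by a multiple of `∫ Re φ |f|² =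
Re ⟨T_φ f, f⟩`, and a coercive operator is invertible.

Luecking's inequality rests on Jensen's: if `|h(0)| = 1` and `h` has bounded mean square on a ball,
then `log |h|` cannot be very negative on average, so `h` cannot be small wherever a weight of
substantial mass lives. This controls `|h(0)|²` by the weighted mean square plus a small multiple of
the unweighted one (`enorm_sq_le_lintegral_add_lintegral`). Taking for `h` the composite of `f` with
the disc involution at `a` makes it an estimate of `|f(a)|²`. Integrating over `a` costs only a
constant (`lintegral_lintegral_discInvolution_le`), and the unweighted term is absorbed on the left.
-/

noncomputable section

namespace BergmanToeplitz

open MeasureTheory Filter Topology Metric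
open scoped ENNReal ComplexConjugate

/-! ### Disc involutions and their change of variables -/

/-- The involutive automorphism `w ↦ (a - w) / (1 - w ā)` of the disc exchanging `0` and `a`. -/
def discInvolution (a w : ℂ) : ℂ := (a - w) / (1 - w * conj a)

theorem norm_mul_conj_lt_one {a w : ℂ} (ha : ‖a‖ < 1) (hw : ‖w‖ < 1) : ‖w * conj a‖ < 1 := by
  rw [norm_mul, RCLike.norm_conj]
  exact mul_lt_one_of_nonneg_of_lt_one_left (norm_nonneg _) hw ha.le

theorem one_sub_mul_conj_ne_zero {a w : ℂ} (ha : ‖a‖ < 1) (hw : ‖w‖ < 1) :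
    1 - w * conj a ≠ 0 := by
  intro h
  have h1 := norm_mul_conj_lt_one ha hw
  rw [← sub_eq_zero.1 h] at h1
  simp at h1

theorem normSq_one_sub_sub_normSq_sub (a w : ℂ) :
    ‖1 - w * conj a‖ ^ 2 - ‖a - w‖ ^ 2 = (1 - ‖a‖ ^ 2) * (1 - ‖w‖ ^ 2) := by
  simp only [← Complex.normSq_eq_norm_sq, Complex.normSq_apply, Complex.sub_re, Complex.sub_im,
    Complex.mul_re, Complex.mul_im, Complex.conj_re, Complex.conj_im, Complex.one_re,
    Complex.one_im]
  ring

theorem one_sub_norm_discInvolution_sq {a w : ℂ} (ha : ‖a‖ < 1) (hw : ‖w‖ < 1) :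
    (1 - ‖discInvolution a w‖ ^ 2) * ‖1 - w * conj a‖ ^ 2 = (1 - ‖a‖ ^ 2) * (1 - ‖w‖ ^ 2) := by
  have h := one_sub_mul_conj_ne_zero ha hw
  have h' : ‖1 - w * conj a‖ ≠ 0 := norm_ne_zero_iff.2 h
  rw [← normSq_one_sub_sub_normSq_sub, discInvolution, norm_div]
  field_simp

theorem norm_discInvolution_lt_one {a w : ℂ} (ha : ‖a‖ < 1) (hw : ‖w‖ < 1) :
    ‖discInvolution a w‖ < 1 := by
  have h := one_sub_norm_discInvolution_sq ha hw
  have h' : 0 < ‖1 - w * conj a‖ := norm_pos_iff.2 (one_sub_mul_conj_ne_zero ha hw)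
  have h1 : 0 < 1 - ‖a‖ ^ 2 := by nlinarith [norm_nonneg a]
  have h2 : 0 < 1 - ‖w‖ ^ 2 := by nlinarith [norm_nonneg w]
  have h3 : 0 < 1 - ‖discInvolution a w‖ ^ 2 :=
    pos_of_mul_pos_left (h ▸ mul_pos h1 h2) (by positivity)
  nlinarith [norm_nonneg (discInvolution a w)]

theorem one_sub_mul_conj_self_ne_zero {a : ℂ} (ha : ‖a‖ < 1) : 1 - a * conj a ≠ 0 :=
  one_sub_mul_conj_ne_zero ha ha

theorem discInvolution_discInvolution {a w : ℂ} (ha : ‖a‖ < 1) (hw : ‖w‖ < 1) :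
    discInvolution a (discInvolution a w) = w := by
  have h := one_sub_mul_conj_ne_zero ha hw
  have h2 := one_sub_mul_conj_self_ne_zero ha
  have h1 : 1 - discInvolution a w * conj a = (1 - a * conj a) / (1 - w * conj a) := by
    rw [discInvolution]; field_simp; ring
  rw [discInvolution, h1, discInvolution]
  field_simp
  ring

/-- The real Jacobian of the involution is therefore `|k_a|²`, the density in the Berezin transform.
-/
theorem hasDerivAt_discInvolution {a w : ℂ} (ha : ‖a‖ < 1) (hw : ‖w‖ < 1) :
    HasDerivAt (discInvolution a) (-normalizedKernel a w) w := by
  have h := one_sub_mul_conj_ne_zero ha hw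
  have h1 : HasDerivAt (fun w : ℂ => a - w) (-1) w := (hasDerivAt_id w).const_sub a
  have h2 : HasDerivAt (fun w : ℂ => 1 - w * conj a) (-(1 * conj a)) w :=
    ((hasDerivAt_id w).mul_const (conj a)).const_sub 1
  refine (h1.div h2 h).congr_deriv ?_
  have h3 : (‖a‖ : ℂ) ^ 2 = a * conj a := (RCLike.mul_conj a).symm
  rw [normalizedKernel, h3]
  field_simp
  ring

theorem det_restrictScalars_toSpanSingleton (c : ℂ) :
    ((ContinuousLinearMap.toSpanSingleton ℂ c).restrictScalars ℝ).det = ‖c‖ ^ 2 := by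
  have h : ((ContinuousLinearMap.toSpanSingleton ℂ c).restrictScalars ℝ : ℂ →ₗ[ℝ] ℂ)
      = Algebra.lmul ℝ ℂ c := by
    ext; simp [mul_comm]
  rw [ContinuousLinearMap.det, h, ← Algebra.norm_apply, Algebra.norm_complex_apply,
    Complex.normSq_eq_norm_sq]

theorem image_discInvolution {a : ℂ} (ha : ‖a‖ < 1) :
    discInvolution a '' ball 0 1 = ball 0 1 := by
  ext w
  simp only [Set.mem_image, mem_ball_zero_iff]
  constructor
  · rintro ⟨u, hu, rfl⟩
    exact norm_discInvolution_lt_one ha hu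
  · intro hw
    exact ⟨_, norm_discInvolution_lt_one ha hw, discInvolution_discInvolution ha hw⟩

theorem lintegral_areaMeasure (F : ℂ → ℝ≥0∞) :
    ∫⁻ w, F w ∂areaMeasure = (ENNReal.ofReal Real.pi)⁻¹ * ∫⁻ w in ball 0 1, F w := by
  rw [areaMeasure, lintegral_smul_measure, smul_eq_mul]

/-- Change of variables under the disc involution. -/
theorem lintegral_discInvolution_mul {a : ℂ} (ha : ‖a‖ < 1) (F : ℂ → ℝ≥0∞) :
    ∫⁻ w, ‖normalizedKernel a w‖ₑ ^ 2 * F (discInvolution a w) ∂areaMeasure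
      = ∫⁻ w, F w ∂areaMeasure := by
  rw [lintegral_areaMeasure, lintegral_areaMeasure]
  congr 1
  have hinj : Set.InjOn (discInvolution a) (ball 0 1) := by
    intro u hu v hv huv
    rw [mem_ball_zero_iff] at hu hv
    rw [← discInvolution_discInvolution ha hu, huv, discInvolution_discInvolution ha hv]
  have h := lintegral_image_eq_lintegral_abs_det_fderiv_mul volume measurableSet_ball
    (fun w hw => ((hasDerivAt_discInvolution ha
      (mem_ball_zero_iff.1 hw)).hasFDerivAt.restrictScalars ℝ).hasFDerivWithinAt) hinj F
  rw [image_discInvolution ha] at h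
  rw [h]
  refine setLIntegral_congr_fun measurableSet_ball fun w _ => ?_
  simp only [det_restrictScalars_toSpanSingleton, norm_neg, abs_pow, abs_norm]
  rw [ENNReal.ofReal_pow (norm_nonneg _), ofReal_norm]

/-- Read from right to left: the Berezin transform at `a` is the plain mean of the function
recentred at `a`. -/
theorem lintegral_comp_discInvolution {a : ℂ} (ha : ‖a‖ < 1) (F : ℂ → ℝ≥0∞) :
    ∫⁻ u, F (discInvolution a u) ∂areaMeasure
      = ∫⁻ w, ‖normalizedKernel a w‖ₑ ^ 2 * F w ∂areaMeasure := by
  rw [← lintegral_discInvolution_mul ha]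
  refine lintegral_congr_ae ?_
  filter_upwards [ae_areaMeasure_mem] with w hw
  rw [discInvolution_discInvolution ha (mem_ball_zero_iff.1 hw)]

theorem lintegral_normalizedKernel {a : ℂ} (ha : ‖a‖ < 1) :
    ∫⁻ w, ‖normalizedKernel a w‖ₑ ^ 2 ∂areaMeasure = 1 := by
  simpa [areaMeasure_univ] using lintegral_discInvolution_mul ha (fun _ => 1)

theorem measurable_normalizedKernel_uncurry :
    Measurable fun p : ℂ × ℂ => normalizedKernel p.1 p.2 := by
  unfold normalizedKernel
  have : Measurable fun z : ℂ => conj z := Complex.continuous_conj.measurable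
  fun_prop

theorem measurable_discInvolution_uncurry :
    Measurable fun p : ℂ × ℂ => discInvolution p.1 p.2 := by
  unfold discInvolution
  have : Measurable fun z : ℂ => conj z := Complex.continuous_conj.measurable
  fun_prop

theorem norm_normalizedKernel {a w : ℂ} (ha : ‖a‖ < 1) :
    ‖normalizedKernel a w‖ = (1 - ‖a‖ ^ 2) / ‖1 - w * conj a‖ ^ 2 := by
  have h : (1 - (‖a‖ : ℂ) ^ 2) = ((1 - ‖a‖ ^ 2 : ℝ) : ℂ) := by push_cast; rfl
  rw [normalizedKernel, norm_div, norm_pow, h, Complex.norm_real, Real.norm_of_nonneg]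
  nlinarith [norm_nonneg a]

/-! ### Averages over pseudohyperbolic discs -/

/-- The kernel is almost symmetric on pseudohyperbolic discs of a fixed radius. -/
theorem norm_normalizedKernel_le {a w : ℂ} {R : ℝ} (hR : R < 1) (ha : ‖a‖ < 1) (hw : ‖w‖ < 1)
    (h : ‖discInvolution a w‖ < R) :
    ‖normalizedKernel a w‖ ≤ 4 / (1 - R ^ 2) * ‖normalizedKernel w a‖ := by
  have hR0 : 0 < R := (norm_nonneg _).trans_lt h
  have hR2 : 0 < 1 - R ^ 2 := by nlinarith
  have h1 := one_sub_norm_discInvolution_sq ha hw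
  have hpos : 0 < ‖1 - w * conj a‖ := norm_pos_iff.2 (one_sub_mul_conj_ne_zero ha hw)
  have ha2 : 0 < 1 - ‖a‖ ^ 2 := by nlinarith [norm_nonneg a]
  have hsymm : ‖1 - a * conj w‖ = ‖1 - w * conj a‖ := by
    rw [← RCLike.norm_conj (1 - w * conj a)]
    simp [mul_comm]
  -- Uses `1 - |a|² = (1 - |a|)(1 + |a|) ≤ 2(1 - |a|)`; squaring this bound produces the constant 4.
  have h2 : (1 - ‖a‖ ^ 2) / 2 ≤ ‖1 - w * conj a‖ := by
    have h3 : 1 - ‖a‖ ≤ ‖1 - w * conj a‖ := by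
      have h4 := norm_sub_norm_le 1 (w * conj a)
      rw [norm_mul, RCLike.norm_conj, norm_one] at h4
      nlinarith [norm_nonneg a]
    nlinarith [norm_nonneg a]
  have h5 : (1 - R ^ 2) * ‖1 - w * conj a‖ ^ 2 ≤ (1 - ‖a‖ ^ 2) * (1 - ‖w‖ ^ 2) := by
    rw [← h1]
    gcongr
  have h6 : (1 - R ^ 2) * (1 - ‖a‖ ^ 2) ≤ 4 * (1 - ‖w‖ ^ 2) := by
    have h7 : ((1 - ‖a‖ ^ 2) / 2) ^ 2 ≤ ‖1 - w * conj a‖ ^ 2 := by gcongr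
    have h8 := (mul_le_mul_of_nonneg_left h7 hR2.le).trans h5
    have h9 : (1 - ‖a‖ ^ 2) * ((1 - R ^ 2) * (1 - ‖a‖ ^ 2))
        ≤ (1 - ‖a‖ ^ 2) * (4 * (1 - ‖w‖ ^ 2)) := by linarith
    exact le_of_mul_le_mul_left h9 ha2
  rw [norm_normalizedKernel ha, norm_normalizedKernel hw, hsymm, ← mul_div_assoc]
  gcongr
  rw [div_mul_eq_mul_div, le_div_iff₀ hR2]
  linarith

/-- Averages over pseudohyperbolic discs of a fixed radius are bounded on `L¹`. -/
theorem lintegral_lintegral_discInvolution_le {R : ℝ} (hR : R < 1) {F : ℂ → ℝ≥0∞}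
    (hF : AEMeasurable F areaMeasure) :
    ∫⁻ a, ∫⁻ u in ball 0 R, F (discInvolution a u) ∂areaMeasure ∂areaMeasure
      ≤ ENNReal.ofReal (4 / (1 - R ^ 2)) ^ 2 * ∫⁻ w, F w ∂areaMeasure := by
  set M := ENNReal.ofReal (4 / (1 - R ^ 2)) with hM
  -- The integrand after the change of variables: `|k_a(w)|²` cut off to a pseudohyperbolic disc,
  -- times `F w`. Tonelli then lets `a` be integrated first.
  let H : ℂ → ℂ → ℝ≥0∞ := fun a w =>
    (ball (0 : ℂ) R).indicator (fun _ => ‖normalizedKernel a w‖ₑ ^ 2) (discInvolution a w) * F w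
  have h1 : ∀ a ∈ ball (0 : ℂ) 1,
      ∫⁻ u in ball 0 R, F (discInvolution a u) ∂areaMeasure
      = ∫⁻ w, H a w ∂areaMeasure := by
    intro a ha
    rw [mem_ball_zero_iff] at ha
    rw [← lintegral_indicator measurableSet_ball, ← lintegral_discInvolution_mul ha]
    refine lintegral_congr_ae ?_
    filter_upwards [ae_areaMeasure_mem] with w hw
    by_cases hmem : discInvolution a w ∈ ball (0 : ℂ) R
    · simp [H, hmem, discInvolution_discInvolution ha (mem_ball_zero_iff.1 hw)]
    · simp [H, hmem]
  have hker : Measurable fun p : ℂ × ℂ => (ball (0 : ℂ) R).indicator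
      (fun _ => ‖normalizedKernel p.1 p.2‖ₑ ^ 2) (discInvolution p.1 p.2) :=
    Measurable.indicator (measurable_normalizedKernel_uncurry.enorm.pow_const 2)
      (measurable_discInvolution_uncurry measurableSet_ball)
  have h2 : ∀ w ∈ ball (0 : ℂ) 1, ∫⁻ a, H a w ∂areaMeasure ≤ M ^ 2 * F w := by
    intro w hw
    rw [mem_ball_zero_iff] at hw
    -- Exchanging `a` and `w` in the kernel costs `M²`; the exchanged kernel has integral 1 in `a`.
    have h3 : ∀ᵐ a ∂areaMeasure, H a w ≤ M ^ 2 * F w * ‖normalizedKernel w a‖ₑ ^ 2 := by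
      filter_upwards [ae_areaMeasure_mem] with a ha
      rw [mem_ball_zero_iff] at ha
      by_cases hmem : discInvolution a w ∈ ball (0 : ℂ) R
      · have h4 := norm_normalizedKernel_le hR ha hw (mem_ball_zero_iff.1 hmem)
        have h5 : ‖normalizedKernel a w‖ₑ ≤ M * ‖normalizedKernel w a‖ₑ := by
          rw [← ofReal_norm, ← ofReal_norm, hM, ← ENNReal.ofReal_mul' (norm_nonneg _)]
          exact ENNReal.ofReal_le_ofReal h4
        simp only [H, hmem, Set.indicator_of_mem]
        calc ‖normalizedKernel a w‖ₑ ^ 2 * F w ≤ (M * ‖normalizedKernel w a‖ₑ) ^ 2 * F w := by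
              gcongr
          _ = _ := by ring
      · simp [H, hmem]
    refine (lintegral_mono_ae h3).trans ?_
    rw [lintegral_const_mul, lintegral_normalizedKernel hw, mul_one]
    exact (measurable_normalizedKernel_uncurry.of_uncurry_left (x := w)).enorm.pow_const 2
  calc ∫⁻ a, ∫⁻ u in ball 0 R, F (discInvolution a u) ∂areaMeasure ∂areaMeasure
      = ∫⁻ a, ∫⁻ w, H a w ∂areaMeasure ∂areaMeasure :=
        lintegral_congr_ae (ae_areaMeasure_mem.mono h1)
    _ = ∫⁻ w, ∫⁻ a, H a w ∂areaMeasure ∂areaMeasure :=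
        lintegral_lintegral_swap (hker.aemeasurable.mul hF.comp_snd)
    _ ≤ ∫⁻ w, M ^ 2 * F w ∂areaMeasure := lintegral_mono_ae (ae_areaMeasure_mem.mono h2)
    _ = _ := lintegral_const_mul' _ _ (by simp [hM])

/-! ### Jensen's inequality on circles and balls -/

/-- Jensen's formula: the average is `log |h(0)| = 0` plus a sum of `log (1/|u|) ≥ 0` over the zeros
`u` in the closed disc, with multiplicity. -/
theorem circleAverage_log_norm_nonneg {h : ℂ → ℂ} (hh : AnalyticOnNhd ℂ h (closedBall 0 1))
    (h0 : ‖h 0‖ = 1) : 0 ≤ Real.circleAverage (fun z => Real.log ‖h z‖) 0 1 := by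
  have hh' : AnalyticOnNhd ℂ h (closedBall 0 |1|) := by rwa [abs_one]
  rw [hh'.circleAverage_log_norm one_ne_zero (norm_ne_zero_iff.1 (by simp [h0])), h0,
    Real.log_one, add_zero]
  refine finsum_nonneg fun u => ?_
  by_cases hu : u ∈ closedBall (0 : ℂ) |1|
  · refine mul_nonneg (mod_cast MeromorphicOn.AnalyticOnNhd.divisor_nonneg hh' _) ?_
    rw [abs_one, mem_closedBall_zero_iff] at hu
    rw [zero_sub, norm_neg, one_mul, Real.log_inv, neg_nonneg]
    exact Real.log_nonpos (norm_nonneg _) hu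
  · simp [Function.locallyFinsuppWithin.apply_eq_zero_of_notMem _ hu]

/-- Splits the nonnegative average into positive and negative parts. Both are finite because `log
|h|` is integrable on the circle even when `h` vanishes there. -/
theorem lintegral_circle_neg_log_le {h : ℂ → ℂ} (hh : AnalyticOnNhd ℂ h (closedBall 0 1))
    (h0 : ‖h 0‖ = 1) :
    ∫⁻ θ in Set.Ioc 0 (2 * Real.pi), ENNReal.ofReal (-Real.log ‖h (circleMap 0 1 θ)‖)
      ≤ ∫⁻ θ in Set.Ioc 0 (2 * Real.pi), ENNReal.ofReal (Real.log ‖h (circleMap 0 1 θ)‖) := by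
  have hpos := circleAverage_log_norm_nonneg hh h0
  have hint : CircleIntegrable (fun z => Real.log ‖h z‖) 0 1 := by
    apply MeromorphicOn.circleIntegrable_log_norm
    rw [abs_one]
    exact (hh.mono sphere_subset_closedBall).meromorphicOn
  have hint' : IntegrableOn (fun θ => Real.log ‖h (circleMap 0 1 θ)‖)
      (Set.Ioc 0 (2 * Real.pi)) :=
    (intervalIntegrable_iff_integrableOn_Ioc_of_le Real.two_pi_pos.le).1 hint
  rw [Real.circleAverage_def, intervalIntegral.integral_of_le Real.two_pi_pos.le,
    integral_eq_lintegral_pos_part_sub_lintegral_neg_part hint', smul_eq_mul] at hpos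
  have h2 := (mul_nonneg_iff_of_pos_left (by positivity)).1 hpos
  have hfin : ∫⁻ θ in Set.Ioc 0 (2 * Real.pi),
      ENNReal.ofReal (-Real.log ‖h (circleMap 0 1 θ)‖) < ⊤ := hint'.neg.lintegral_lt_top
  have hfin' := hint'.lintegral_lt_top
  rw [← ENNReal.toReal_le_toReal hfin.ne hfin'.ne]
  exact sub_nonneg.1 h2

theorem lintegral_rotation (F : ℂ → ℝ≥0∞) (θ : ℝ) :
    ∫⁻ w, F (circleMap 0 1 θ * w) ∂areaMeasure = ∫⁻ w, F w ∂areaMeasure := by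
  rw [lintegral_areaMeasure, lintegral_areaMeasure]
  congr 1
  have hp : MeasurePreserving (rotation (Circle.exp θ)) volume volume :=
    (rotation (Circle.exp θ)).measurePreserving
  have he : MeasurableEmbedding (rotation (Circle.exp θ)) :=
    (rotation (Circle.exp θ)).toHomeomorph.measurableEmbedding
  rw [← hp.setLIntegral_comp_preimage_emb he F]
  have : (rotation (Circle.exp θ)) ⁻¹' ball (0 : ℂ) 1 = ball 0 1 := by
    ext w; simp only [Set.mem_preimage, mem_ball_zero_iff, LinearIsometryEquiv.norm_map]
  rw [this]
  simp [circleMap, rotation_apply]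

/-- Averaging over rotations passes from circles to area without polar coordinates. -/
theorem lintegral_lintegral_circleMap_mul {F : ℂ → ℝ≥0∞} (hF : Measurable F) :
    ∫⁻ w, (∫⁻ θ in Set.Ioc 0 (2 * Real.pi), F (circleMap 0 1 θ * w)) ∂areaMeasure
      = (∫⁻ w, F w ∂areaMeasure) * ENNReal.ofReal (2 * Real.pi) := by
  rw [lintegral_lintegral_swap]
  · simp_rw [lintegral_rotation]
    simp
  · have : Measurable fun p : ℂ × ℝ => circleMap 0 1 p.2 * p.1 := by
      have := (continuous_circleMap 0 1).measurable
      fun_prop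
    exact (hF.comp this).aemeasurable

/-- Area form of Jensen's inequality. -/
theorem lintegral_ball_neg_log_le {h : ℂ → ℂ} (hh : DifferentiableOn ℂ h (ball 0 1))
    (h0 : ‖h 0‖ = 1) {R : ℝ} (hR : R ≤ 1) :
    ∫⁻ w in ball 0 R, ENNReal.ofReal (-Real.log ‖h w‖) ∂areaMeasure
      ≤ ∫⁻ w in ball 0 R, ENNReal.ofReal (Real.log ‖h w‖) ∂areaMeasure := by
  classical
  have hm : Measurable ((ball (0 : ℂ) 1).piecewise h 0) :=
    hh.continuousOn.measurable_piecewise continuousOn_const measurableSet_ball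
  have hpw : ∀ G : ℂ → ℝ≥0∞, Measurable G →
      Measurable ((ball (0 : ℂ) R).indicator fun w => G (h w)) := by
    intro G hG
    have : ((ball (0 : ℂ) R).indicator fun w => G (h w))
        = (ball (0 : ℂ) R).indicator fun w => G ((ball (0 : ℂ) 1).piecewise h 0 w) := by
      ext w
      by_cases hw : w ∈ ball (0 : ℂ) R
      · rw [Set.indicator_of_mem hw, Set.indicator_of_mem hw,
          Set.piecewise_eq_of_mem _ _ _ (ball_subset_ball hR hw)]
      · simp [hw]
    rw [this]
    exact (hG.comp hm).indicator measurableSet_ball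
  have h2pi : ENNReal.ofReal (2 * Real.pi) ≠ 0 := by simpa using Real.pi_pos
  rw [← ENNReal.mul_le_mul_iff_left h2pi ENNReal.ofReal_ne_top,
    ← lintegral_indicator measurableSet_ball, ← lintegral_indicator measurableSet_ball,
    ← lintegral_lintegral_circleMap_mul (hpw (fun z => ENNReal.ofReal (-Real.log ‖z‖))
      (by fun_prop)),
    ← lintegral_lintegral_circleMap_mul (hpw (fun z => ENNReal.ofReal (Real.log ‖z‖))
      (by fun_prop))]
  refine lintegral_mono fun w => ?_
  have hmem : ∀ θ : ℝ, circleMap 0 1 θ * w ∈ ball (0 : ℂ) R ↔ w ∈ ball (0 : ℂ) R := by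
    simp
  by_cases hw : w ∈ ball (0 : ℂ) R
  -- For fixed `w`, the circle inequality is applied to `u ↦ h (u * w)`, whose value at `0` is still
  -- `h 0`.
  · have han : AnalyticOnNhd ℂ (fun u => h (u * w)) (closedBall 0 1) := by
      intro u hu
      have huw : u * w ∈ ball (0 : ℂ) 1 := by
        rw [mem_ball_zero_iff] at hw ⊢
        rw [mem_closedBall_zero_iff] at hu
        rw [norm_mul]
        nlinarith [norm_nonneg w, norm_nonneg u]
      exact (hh.analyticAt (isOpen_ball.mem_nhds huw)).comp (f := fun u => u * w) (by fun_prop)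
    have := lintegral_circle_neg_log_le han (by simpa using h0)
    simpa only [Set.indicator, hmem, hw, if_true] using this
  · simp [Set.indicator, hmem, hw]

/-- Needed because `Real.log 0 = 0`: at a zero of `h` the logarithm would not record that `h` is
small. -/
theorem ae_ne_zero_of_differentiableOn {h : ℂ → ℂ} (hh : DifferentiableOn ℂ h (ball 0 1))
    (h0 : h 0 ≠ 0) : ∀ᵐ w ∂areaMeasure, h w ≠ 0 := by
  have han : AnalyticOnNhd ℂ h (ball 0 1) := hh.analyticOnNhd isOpen_ball
  have h1 := han.preimage_zero_mem_codiscreteWithin (x := 0) h0 (by simp)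
    ((convex_ball 0 1).isConnected ⟨0, by simp⟩)
  refine Measure.ae_smul_measure ?_ _
  filter_upwards [ae_restrict_le_codiscreteWithin measurableSet_ball h1] with w hw
  simpa using hw

/-! ### The local estimate at the centre -/

/-- Either the mean square of `h` is at least `K`, and the first term suffices, or Jensen bounds `∫
log⁻ |h|` by `K`. In the second case `h` is very small only on a set carrying little of the weight
`g`. -/
theorem one_le_lintegral_add_lintegral {h : ℂ → ℂ} (hh : DifferentiableOn ℂ h (ball 0 1))
    (h0 : ‖h 0‖ = 1) {R C δ K : ℝ} (hR : R ≤ 1) (hC : 0 < C) (hδ : 0 < δ) (hK : 0 < K)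
    {g : ℂ → ℝ≥0∞} (hg : ∀ w ∈ ball (0 : ℂ) R, g w ≤ ENNReal.ofReal C)
    (hgδ : ENNReal.ofReal δ ≤ ∫⁻ w in ball 0 R, g w ∂areaMeasure) :
    1 ≤ ENNReal.ofReal K⁻¹ * ∫⁻ w in ball 0 R, ‖h w‖ₑ ^ 2 ∂areaMeasure
      + ENNReal.ofReal (2 / δ * Real.exp (4 * C * K / δ)) *
        ∫⁻ w in ball 0 R, g w * ‖h w‖ₑ ^ 2 ∂areaMeasure := by
  rcases le_or_gt (ENNReal.ofReal K) (∫⁻ w in ball 0 R, ‖h w‖ₑ ^ 2 ∂areaMeasure) with hle | hlt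
  · refine le_add_right ?_
    calc (1 : ℝ≥0∞) = ENNReal.ofReal K⁻¹ * ENNReal.ofReal K := by
          rw [← ENNReal.ofReal_mul (by positivity), inv_mul_cancel₀ hK.ne', ENNReal.ofReal_one]
      _ ≤ _ := by gcongr
  refine le_add_left ?_
  -- The threshold `|h| = exp (-lam)` between small and not small. With this value `lam * δ = 2CK`,
  -- twice the loss `CK` from Jensen, so one `CK` survives.
  set lam : ℝ := 2 * C * K / δ with hlam
  have hlampos : 0 < lam := by positivity
  set I := ∫⁻ w in ball 0 R, g w * ‖h w‖ₑ ^ 2 ∂areaMeasure with hI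
  have hlog : ∫⁻ w in ball 0 R, ENNReal.ofReal (-Real.log ‖h w‖) ∂areaMeasure
      ≤ ENNReal.ofReal K := by
    refine (lintegral_ball_neg_log_le hh h0 hR).trans (le_trans ?_ hlt.le)
    refine lintegral_mono fun w => ?_
    rw [← ofReal_norm, ← ENNReal.ofReal_pow (norm_nonneg _)]
    refine ENNReal.ofReal_le_ofReal ?_
    rcases (norm_nonneg (h w)).eq_or_lt with h1 | h1
    · simp [← h1]
    -- `log t ≤ t - 1 ≤ t²`.
    · nlinarith [Real.log_le_sub_one_of_pos h1, sq_nonneg (‖h w‖ - 1)]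
  have hpt : ∀ᵐ w ∂(areaMeasure.restrict (ball 0 R)), ENNReal.ofReal lam * g w ≤
      ENNReal.ofReal C * ENNReal.ofReal (-Real.log ‖h w‖)
        + ENNReal.ofReal (lam * Real.exp (2 * lam)) * (g w * ‖h w‖ₑ ^ 2) := by
    filter_upwards [ae_restrict_mem measurableSet_ball,
      ae_restrict_of_ae (ae_ne_zero_of_differentiableOn hh (norm_ne_zero_iff.1 (by simp [h0])))]
      with w hw hne
    have hpos : 0 < ‖h w‖ := norm_pos_iff.2 hne
    -- Where `h` is small, `lam ≤ log⁻ |h|` and `g ≤ C`; elsewhere `1 ≤ exp (2 * lam) * |h|²`.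
    rcases le_or_gt lam (-Real.log ‖h w‖) with hl | hl
    · refine le_add_right ?_
      rw [mul_comm (ENNReal.ofReal C)]
      gcongr
      exact hg w hw
    · refine le_add_left ?_
      have h1 : 1 ≤ Real.exp (2 * lam) * ‖h w‖ ^ 2 := by
        have h2 : Real.exp (-lam) ≤ ‖h w‖ := by
          rw [← Real.le_log_iff_exp_le hpos]; linarith
        have h3 : 1 ≤ Real.exp lam * ‖h w‖ := by
          calc 1 = Real.exp lam * Real.exp (-lam) := by rw [← Real.exp_add]; simp
            _ ≤ _ := by gcongr
        calc (1 : ℝ) ≤ (Real.exp lam * ‖h w‖) ^ 2 := one_le_pow₀ h3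
          _ = _ := by rw [mul_pow, ← Real.exp_nat_mul]; norm_num
      have h4 : 1 ≤ ENNReal.ofReal (Real.exp (2 * lam)) * ‖h w‖ₑ ^ 2 := by
        rw [← ofReal_norm, ← ENNReal.ofReal_pow (norm_nonneg _),
          ← ENNReal.ofReal_mul (by positivity), ← ENNReal.ofReal_one]
        exact ENNReal.ofReal_le_ofReal h1
      rw [ENNReal.ofReal_mul hlampos.le]
      calc ENNReal.ofReal lam * g w = ENNReal.ofReal lam * g w * 1 := (mul_one _).symm
        _ ≤ ENNReal.ofReal lam * g w * (ENNReal.ofReal (Real.exp (2 * lam)) * ‖h w‖ₑ ^ 2) := by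
            gcongr
        _ = _ := by ring
  have hmeas : AEMeasurable (fun w => ENNReal.ofReal C * ENNReal.ofReal (-Real.log ‖h w‖))
      (areaMeasure.restrict (ball 0 R)) := by
    have h1 : AEMeasurable h (areaMeasure.restrict (ball 0 R)) :=
      (hh.continuousOn.mono (ball_subset_ball hR)).aemeasurable measurableSet_ball
    fun_prop
  have hsum := lintegral_mono_ae hpt
  rw [lintegral_const_mul' _ _ ENNReal.ofReal_ne_top, lintegral_add_left' hmeas,
    lintegral_const_mul' _ _ ENNReal.ofReal_ne_top,
    lintegral_const_mul' _ _ ENNReal.ofReal_ne_top] at hsum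
  have h5 : ENNReal.ofReal (C * K) + ENNReal.ofReal (C * K)
      ≤ ENNReal.ofReal (C * K) + ENNReal.ofReal (lam * Real.exp (2 * lam)) * I := by
    calc ENNReal.ofReal (C * K) + ENNReal.ofReal (C * K) = ENNReal.ofReal lam * ENNReal.ofReal δ := by
          rw [← ENNReal.ofReal_add (by positivity) (by positivity),
            ← ENNReal.ofReal_mul (by positivity), hlam]
          congr 1
          field_simp
          ring
      _ ≤ _ := by gcongr
      _ ≤ _ := hsum
      _ ≤ _ := by
          rw [ENNReal.ofReal_mul hC.le]
          gcongr
  have h6 := (ENNReal.add_le_add_iff_left ENNReal.ofReal_ne_top).1 h5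
  calc (1 : ℝ≥0∞) = ENNReal.ofReal (C * K)⁻¹ * ENNReal.ofReal (C * K) := by
        rw [← ENNReal.ofReal_mul (by positivity), inv_mul_cancel₀ (by positivity),
          ENNReal.ofReal_one]
    _ ≤ ENNReal.ofReal (C * K)⁻¹ * (ENNReal.ofReal (lam * Real.exp (2 * lam)) * I) := by gcongr
    _ = _ := by
        rw [← mul_assoc, ← ENNReal.ofReal_mul (by positivity), hlam]
        congr 2
        rw [show 2 * (2 * C * K / δ) = 4 * C * K / δ by ring]
        field_simp

/-- A local lower bound: unless the mean square of `h` over the ball of radius `R` is large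
compared with `|h(0)|²`, the value `|h(0)|²` is controlled by the weighted mean square. -/
theorem enorm_sq_le_lintegral_add_lintegral {h : ℂ → ℂ} (hh : DifferentiableOn ℂ h (ball 0 1))
    {R C δ K : ℝ} (hR : R ≤ 1) (hC : 0 < C) (hδ : 0 < δ) (hK : 0 < K)
    {g : ℂ → ℝ≥0∞} (hg : ∀ w ∈ ball (0 : ℂ) R, g w ≤ ENNReal.ofReal C)
    (hgδ : ENNReal.ofReal δ ≤ ∫⁻ w in ball 0 R, g w ∂areaMeasure) :
    ‖h 0‖ₑ ^ 2 ≤ ENNReal.ofReal K⁻¹ * ∫⁻ w in ball 0 R, ‖h w‖ₑ ^ 2 ∂areaMeasure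
      + ENNReal.ofReal (2 / δ * Real.exp (4 * C * K / δ)) *
        ∫⁻ w in ball 0 R, g w * ‖h w‖ₑ ^ 2 ∂areaMeasure := by
  by_cases h0 : h 0 = 0
  · simp [h0]
  have h1 := one_le_lintegral_add_lintegral (hh.const_mul (h 0)⁻¹)
    (by rw [inv_mul_cancel₀ h0, norm_one]) hR hC hδ hK hg hgδ
  have htop : ‖h 0‖ₑ ^ 2 ≠ ⊤ := by simp
  have hsc : ∀ w, ‖h 0‖ₑ ^ 2 * ‖(h 0)⁻¹ * h w‖ₑ ^ 2 = ‖h w‖ₑ ^ 2 := by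
    intro w
    rw [← mul_pow, ← enorm_mul, mul_inv_cancel_left₀ h0]
  calc ‖h 0‖ₑ ^ 2 = ‖h 0‖ₑ ^ 2 * 1 := (mul_one _).symm
    _ ≤ _ := mul_le_mul' le_rfl h1
    _ = _ := by
      rw [mul_add, mul_left_comm, mul_left_comm (‖h 0‖ₑ ^ 2) (ENNReal.ofReal _),
        ← lintegral_const_mul' _ _ htop, ← lintegral_const_mul' _ _ htop]
      simp_rw [mul_left_comm (‖h 0‖ₑ ^ 2) (g _), hsc]

/-! ### Luecking's inequality -/

theorem areaMeasure_ball {R : ℝ} (hR0 : 0 ≤ R) (hR : R ≤ 1) :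
    areaMeasure (ball 0 R) = ENNReal.ofReal (R ^ 2) := by
  have h : (ENNReal.ofReal Real.pi) = (NNReal.pi : ℝ≥0∞) := by
    rw [ENNReal.ofReal, ← NNReal.coe_real_pi, Real.toNNReal_coe]
  rw [areaMeasure, Measure.smul_apply, Measure.restrict_apply measurableSet_ball,
    Set.inter_eq_left.2 (ball_subset_ball hR), Complex.volume_ball, smul_eq_mul, ← h,
    mul_left_comm, ENNReal.inv_mul_cancel ofReal_pi_ne_zero ENNReal.ofReal_ne_top, mul_one,
    ENNReal.ofReal_pow hR0]

/-- Passing from the whole disc to a large ball loses little of the mean of a bounded function. -/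
theorem ofReal_half_le_lintegral_ball {C δ R : ℝ} (hC : 0 < C) (hδ : 0 < δ)
    (hR0 : 0 ≤ R) (hR : R ≤ 1) (hCR : C * (1 - R ^ 2) ≤ δ / 2) {g : ℂ → ℝ≥0∞}
    (hg : ∀ w ∈ ball (0 : ℂ) 1, g w ≤ ENNReal.ofReal C)
    (hgδ : ENNReal.ofReal δ ≤ ∫⁻ w, g w ∂areaMeasure) :
    ENNReal.ofReal (δ / 2) ≤ ∫⁻ w in ball 0 R, g w ∂areaMeasure := by
  have h1 : ∫⁻ w in (ball 0 R)ᶜ, g w ∂areaMeasure ≤ ENNReal.ofReal (δ / 2) := by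
    calc ∫⁻ w in (ball 0 R)ᶜ, g w ∂areaMeasure
        ≤ ∫⁻ _ in (ball 0 R)ᶜ, ENNReal.ofReal C ∂areaMeasure :=
          lintegral_mono_ae (ae_restrict_of_ae (ae_areaMeasure_mem.mono hg))
      _ = ENNReal.ofReal (C * (1 - R ^ 2)) := by
          rw [setLIntegral_const, prob_compl_eq_one_sub measurableSet_ball,
            areaMeasure_ball hR0 hR, ENNReal.ofReal_mul hC.le,
            ENNReal.ofReal_sub _ (by positivity), ENNReal.ofReal_one]
      _ ≤ _ := ENNReal.ofReal_le_ofReal hCR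
  rw [← lintegral_add_compl g measurableSet_ball] at hgδ
  have h2 : ENNReal.ofReal (δ / 2) + ENNReal.ofReal (δ / 2)
      ≤ ∫⁻ w in ball 0 R, g w ∂areaMeasure + ENNReal.ofReal (δ / 2) := by
    rw [← ENNReal.ofReal_add (by positivity) (by positivity), add_halves]
    exact hgδ.trans (by gcongr)
  exact (ENNReal.add_le_add_iff_right ENNReal.ofReal_ne_top).1 h2

/-- **Luecking's inequality**: a bounded nonnegative weight whose Berezin transform is bounded
below defines a norm on the Bergman space equivalent to the original one. -/
theorem exists_lintegral_enorm_sq_le {C δ : ℝ} (hδ : 0 < δ) {g : ℂ → ℝ≥0∞}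
    (hgm : AEMeasurable g areaMeasure) (hg : ∀ w ∈ ball (0 : ℂ) 1, g w ≤ ENNReal.ofReal C)
    (hB : ∀ᵐ a ∂areaMeasure,
      ENNReal.ofReal δ ≤ ∫⁻ w, ‖normalizedKernel a w‖ₑ ^ 2 * g w ∂areaMeasure) :
    ∃ N : ℝ, 0 < N ∧ ∀ f : ℂ → ℂ, DifferentiableOn ℂ f (ball 0 1) → Measurable f →
      ∫⁻ w, ‖f w‖ₑ ^ 2 ∂areaMeasure ≠ ⊤ →
      ∫⁻ w, ‖f w‖ₑ ^ 2 ∂areaMeasure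
        ≤ ENNReal.ofReal N * ∫⁻ w, g w * ‖f w‖ₑ ^ 2 ∂areaMeasure := by
  -- Enlarging `C` keeps the bound on `g` and makes the radicand defining `R` nonnegative.
  wlog hCδ : δ ≤ C generalizing C
  · exact this (C := max C δ)
      (fun w hw => (hg w hw).trans (ENNReal.ofReal_le_ofReal (le_max_left _ _)))
      (le_max_right _ _)
  have hC : 0 < C := hδ.trans_le hCδ
  -- Chosen so that `C(1 - R²) = δ/2`: at least half of the lower bound `δ` survives on the ball of
  -- radius `R`.
  set R : ℝ := Real.sqrt (1 - δ / (2 * C)) with hRdef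
  have hq : δ / (2 * C) ≤ 1 := by rw [div_le_one (by positivity)]; linarith
  have hq0 : 0 < δ / (2 * C) := by positivity
  have hR0 : 0 ≤ R := Real.sqrt_nonneg _
  have hR2 : R ^ 2 = 1 - δ / (2 * C) := Real.sq_sqrt (by linarith)
  have hR1 : R < 1 := by nlinarith
  have hR2' : 1 - R ^ 2 = δ / (2 * C) := by rw [hR2]; ring
  set M : ℝ := (4 / (1 - R ^ 2)) ^ 2 with hM
  have hMpos : 0 < M := by rw [hM, hR2']; positivity
  have hMof : ENNReal.ofReal (4 / (1 - R ^ 2)) ^ 2 = ENNReal.ofReal M := by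
    rw [hM, ENNReal.ofReal_pow]; rw [hR2']; positivity
  -- The constant of the local estimate with `δ/2` for `δ` and `K = 2M`; averaging costs a factor
  -- `M`, so the unweighted term returns as `X / 2`.
  set E : ℝ := 2 / (δ / 2) * Real.exp (4 * C * (2 * M) / (δ / 2)) with hE
  have hEpos : 0 < E := by positivity
  refine ⟨2 * (E * M), by positivity, fun f hf hfm hfin => ?_⟩
  set X := ∫⁻ w, ‖f w‖ₑ ^ 2 ∂areaMeasure with hX
  set Y := ∫⁻ w, g w * ‖f w‖ₑ ^ 2 ∂areaMeasure with hY
  have hfm2 : Measurable fun w => ‖f w‖ₑ ^ 2 := hfm.enorm.pow_const 2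
  have hpt : ∀ᵐ a ∂areaMeasure, ‖f a‖ₑ ^ 2 ≤
      ENNReal.ofReal (2 * M)⁻¹ * ∫⁻ w in ball 0 R, ‖f (discInvolution a w)‖ₑ ^ 2 ∂areaMeasure
      + ENNReal.ofReal E * ∫⁻ w in ball 0 R,
        g (discInvolution a w) * ‖f (discInvolution a w)‖ₑ ^ 2 ∂areaMeasure := by
    filter_upwards [hB, ae_areaMeasure_mem] with a hBa ha
    rw [mem_ball_zero_iff] at ha
    have hmaps : Set.MapsTo (discInvolution a) (ball 0 1) (ball 0 1) := fun w hw =>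
      mem_ball_zero_iff.2 (norm_discInvolution_lt_one ha (mem_ball_zero_iff.1 hw))
    have hd : DifferentiableOn ℂ (fun w => f (discInvolution a w)) (ball 0 1) :=
      hf.comp (fun w hw => (hasDerivAt_discInvolution ha
        (mem_ball_zero_iff.1 hw)).differentiableAt.differentiableWithinAt) hmaps
    rw [← lintegral_comp_discInvolution ha] at hBa
    have h1 := ofReal_half_le_lintegral_ball hC hδ hR0 hR1.le
      (by rw [hR2']; apply le_of_eq; field_simp) (fun w hw => hg _ (hmaps hw)) hBa
    have h2 := enorm_sq_le_lintegral_add_lintegral hd hR1.le hC (half_pos hδ)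
      (K := 2 * M) (by positivity) (fun w hw => hg _ (hmaps (ball_subset_ball hR1.le hw))) h1
    have h0 : discInvolution a 0 = a := by simp [discInvolution]
    simpa only [h0] using h2
  have hmeas : Measurable fun a => ENNReal.ofReal (2 * M)⁻¹ *
      ∫⁻ w in ball 0 R, ‖f (discInvolution a w)‖ₑ ^ 2 ∂areaMeasure :=
    (Measurable.lintegral_prod_right' (f := fun p : ℂ × ℂ => ‖f (discInvolution p.1 p.2)‖ₑ ^ 2)
      (hfm2.comp measurable_discInvolution_uncurry)).const_mul _
  have hsum := lintegral_mono_ae hpt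
  rw [lintegral_add_left hmeas, lintegral_const_mul' _ _ ENNReal.ofReal_ne_top,
    lintegral_const_mul' _ _ ENNReal.ofReal_ne_top] at hsum
  have h3 := lintegral_lintegral_discInvolution_le hR1 hfm2.aemeasurable
  have h4 := lintegral_lintegral_discInvolution_le hR1 (hgm.mul hfm2.aemeasurable)
  rw [hMof] at h3 h4
  have h5 : X ≤ X / 2 + ENNReal.ofReal (E * M) * Y := by
    calc X ≤ _ := hsum
      _ ≤ ENNReal.ofReal (2 * M)⁻¹ * (ENNReal.ofReal M * X)
          + ENNReal.ofReal E * (ENNReal.ofReal M * Y) :=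
        add_le_add (mul_le_mul' le_rfl h3) (mul_le_mul' le_rfl h4)
      _ = _ := by
        rw [← mul_assoc, ← mul_assoc, ← ENNReal.ofReal_mul (by positivity),
          ← ENNReal.ofReal_mul (by positivity)]
        congr 1
        rw [show (2 * M)⁻¹ * M = 2⁻¹ by field_simp, ENNReal.ofReal_inv_of_pos two_pos,
          ENNReal.ofReal_ofNat, ENNReal.div_eq_inv_mul]
  have h6 : X / 2 ≤ ENNReal.ofReal (E * M) * Y := by
    -- Absorption of `X / 2`, legitimate because `X` is finite.
    rw [← ENNReal.add_le_add_iff_left (a := X / 2) (ENNReal.div_ne_top hfin two_ne_zero),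
      ENNReal.add_halves]
    exact h5
  calc X = 2 * (X / 2) := (ENNReal.mul_div_cancel two_ne_zero ENNReal.ofNat_ne_top).symm
    _ ≤ 2 * (ENNReal.ofReal (E * M) * Y) := by gcongr
    _ = _ := by
      rw [ENNReal.ofReal_mul (p := 2) (q := E * M) two_pos.le, ENNReal.ofReal_ofNat,
        mul_assoc (2 : ℝ≥0∞)]

/-! ### From a coercive quadratic form to invertibility -/

theorem eLpNorm_two_sq (f : ℂ → ℂ) :
    eLpNorm f 2 areaMeasure ^ 2 = ∫⁻ w, ‖f w‖ₑ ^ 2 ∂areaMeasure := by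
  have h := eLpNorm_nnreal_pow_eq_lintegral (p := 2) (f := f) (μ := areaMeasure) two_ne_zero
  simpa using h

theorem enorm_sq_eq_lintegral (F : L2) {f : ℂ → ℂ} (h : F =ᵐ[areaMeasure] f) :
    ‖F‖ₑ ^ 2 = ∫⁻ w, ‖f w‖ₑ ^ 2 ∂areaMeasure := by
  rw [Lp.enorm_def, eLpNorm_congr_ae h, eLpNorm_two_sq]

theorem exists_measurable_holomorphic_representative (F : bergmanSpace) :
    ∃ f : ℂ → ℂ, DifferentiableOn ℂ f (ball 0 1) ∧ Measurable f ∧ (F : L2) =ᵐ[areaMeasure] f := by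
  classical
  obtain ⟨f, hf, hF⟩ := F.2
  refine ⟨(ball (0 : ℂ) 1).piecewise f 0, ?_, ?_, ?_⟩
  · exact hf.congr fun w hw => Set.piecewise_eq_of_mem _ _ _ hw
  · exact hf.continuousOn.measurable_piecewise continuousOn_const measurableSet_ball
  · filter_upwards [hF, ae_areaMeasure_mem] with w hw hw1
    rw [hw, Set.piecewise_eq_of_mem _ _ _ hw1]

/-- The projection drops out because `F` already lies in the Bergman space, and what remains is a
pointwise product. -/
theorem re_inner_toeplitz {φ : ℂ → ℂ} (hφ : MemLp φ ∞ areaMeasure)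
    (hre : ∀ z ∈ ball (0 : ℂ) 1, 0 ≤ (φ z).re) (F : bergmanSpace) {f : ℂ → ℂ}
    (hF : (F : L2) =ᵐ[areaMeasure] f) :
    ENNReal.ofReal (inner ℂ (toeplitz φ hφ F) F).re
      = ∫⁻ w, ENNReal.ofReal (φ w).re * ‖f w‖ₑ ^ 2 ∂areaMeasure := by
  have h1 : inner ℂ (toeplitz φ hφ F) F = inner ℂ (mulOperator φ hφ (F : L2)) (F : L2) :=
    bergmanSpace.inner_orthogonalProjectionOnto_eq_of_mem_right F _
  have hint := L2.integrable_inner (𝕜 := ℂ) (mulOperator φ hφ (F : L2)) (F : L2)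
  have hpt : ∀ᵐ w ∂areaMeasure,
      (inner ℂ ((mulOperator φ hφ (F : L2) : L2) w) ((F : L2) w)).re
        = (φ w).re * ‖f w‖ ^ 2 := by
    filter_upwards [mulOperator_ae_eq φ hφ F, hF] with w hw hw2
    rw [hw, hw2, RCLike.inner_apply, ← Complex.normSq_eq_norm_sq, Complex.normSq_apply]
    simp
    ring
  have h2 : (inner ℂ (mulOperator φ hφ (F : L2)) (F : L2)).re
      = ∫ w, (inner ℂ ((mulOperator φ hφ (F : L2) : L2) w) ((F : L2) w)).re ∂areaMeasure := by
    rw [L2.inner_def]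
    exact (integral_re hint).symm
  have hint' : Integrable (fun w =>
      (inner ℂ ((mulOperator φ hφ (F : L2) : L2) w) ((F : L2) w)).re) areaMeasure := hint.re
  rw [h1, h2, ofReal_integral_eq_lintegral_ofReal hint']
  · refine lintegral_congr_ae ?_
    filter_upwards [hpt, ae_areaMeasure_mem] with w hw hw1
    rw [hw, ENNReal.ofReal_mul (hre w hw1), ENNReal.ofReal_pow (norm_nonneg _), ofReal_norm]
  · filter_upwards [hpt, ae_areaMeasure_mem] with w hw hw1
    exact hw ▸ mul_nonneg (hre w hw1) (by positivity)

/-- Lax–Milgram: the estimate says `‖F‖² ≤ N Re ⟨T_φ F, F⟩`. -/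
theorem isUnit_toeplitz_of_lintegral_le {φ : ℂ → ℂ} (hφ : MemLp φ ∞ areaMeasure)
    (hre : ∀ z ∈ ball (0 : ℂ) 1, 0 ≤ (φ z).re) {N : ℝ} (hN : 0 < N)
    (h : ∀ f : ℂ → ℂ, DifferentiableOn ℂ f (ball 0 1) → Measurable f →
      ∫⁻ w, ‖f w‖ₑ ^ 2 ∂areaMeasure ≠ ⊤ → ∫⁻ w, ‖f w‖ₑ ^ 2 ∂areaMeasure
        ≤ ENNReal.ofReal N * ∫⁻ w, ENNReal.ofReal (φ w).re * ‖f w‖ₑ ^ 2 ∂areaMeasure) :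
    IsUnit (toeplitz φ hφ) := by
  refine ContinuousLinearMap.isUnit_of_forall_le_norm_inner_map (toeplitz φ hφ)
    (c := ⟨N⁻¹, by positivity⟩) (by exact_mod_cast inv_pos.2 hN) fun F => ?_
  obtain ⟨f, hf, hfm, hF⟩ := exists_measurable_holomorphic_representative F
  have hnorm := enorm_sq_eq_lintegral F hF
  have h1 := h f hf hfm (by rw [← hnorm]; simp)
  rw [← hnorm, ← re_inner_toeplitz hφ hre F hF, ← ENNReal.ofReal_mul hN.le, ← ofReal_norm,
    ← ENNReal.ofReal_pow (norm_nonneg _)] at h1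
  have hle : (inner ℂ (toeplitz φ hφ F) F).re ≤ ‖inner ℂ (toeplitz φ hφ F) F‖ :=
    Complex.re_le_norm _
  have h2 : ‖F‖ ^ 2 ≤ N * ‖inner ℂ (toeplitz φ hφ F) F‖ := by
    rw [← ENNReal.ofReal_le_ofReal_iff (by positivity)]
    exact h1.trans (ENNReal.ofReal_le_ofReal (by gcongr))
  change ‖F‖ ^ 2 * N⁻¹ ≤ _
  rw [← div_eq_mul_inv, div_le_iff₀ hN, mul_comm]
  exact h2

/-! ### Normalized kernels as test vectors -/

theorem measurable_normalizedKernel (a : ℂ) : Measurable (normalizedKernel a) :=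
  measurable_normalizedKernel_uncurry.of_uncurry_left (x := a)

theorem differentiableOn_normalizedKernel {a : ℂ} (ha : ‖a‖ < 1) :
    DifferentiableOn ℂ (normalizedKernel a) (ball 0 1) := by
  intro w hw
  have h := one_sub_mul_conj_ne_zero ha (mem_ball_zero_iff.1 hw)
  have h2 : (1 - w * conj a) ^ 2 ≠ 0 := pow_ne_zero 2 h
  have h3 : DifferentiableAt ℂ (fun w : ℂ => (1 - w * conj a) ^ 2) w := by fun_prop
  exact ((differentiableAt_const _).div h3 h2).differentiableWithinAt

theorem memLp_normalizedKernel {a : ℂ} (ha : ‖a‖ < 1) :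
    MemLp (normalizedKernel a) 2 areaMeasure := by
  refine ⟨(measurable_normalizedKernel a).aestronglyMeasurable, ?_⟩
  have h := eLpNorm_two_sq (normalizedKernel a)
  rw [lintegral_normalizedKernel ha] at h
  rw [lt_top_iff_ne_top]
  intro htop
  simp [htop] at h

/-- A bounded below Toeplitz operator is bounded below on normalized kernels. -/
theorem one_le_of_norm_le_toeplitz {φ : ℂ → ℂ} (hφ : MemLp φ ∞ areaMeasure) {C N : ℝ}
    (hC : ∀ z ∈ ball (0 : ℂ) 1, ‖φ z‖ ≤ C)
    (h : ∀ F : bergmanSpace, ‖F‖ ≤ N * ‖toeplitz φ hφ F‖) {a : ℂ} (ha : ‖a‖ < 1) :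
    1 ≤ ENNReal.ofReal (N ^ 2 * C) *
      ∫⁻ w, ‖normalizedKernel a w‖ₑ ^ 2 * ‖φ w‖ₑ ∂areaMeasure := by
  set k : L2 := (memLp_normalizedKernel ha).toLp _ with hk
  have hkae : k =ᵐ[areaMeasure] normalizedKernel a := (memLp_normalizedKernel ha).coeFn_toLp
  let K : bergmanSpace := ⟨k, _, differentiableOn_normalizedKernel ha, hkae⟩
  have hnorm : ‖k‖ₑ ^ 2 = 1 := by
    rw [enorm_sq_eq_lintegral k hkae, lintegral_normalizedKernel ha]
  have hproj : ‖toeplitz φ hφ K‖ ≤ ‖mulOperator φ hφ k‖ := by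
    refine (bergmanSpace.orthogonalProjectionOnto.le_opNorm _).trans ?_
    exact mul_le_of_le_one_left (norm_nonneg _) (Submodule.orthogonalProjectionOnto_norm_le _)
  have hmul : ‖mulOperator φ hφ k‖ₑ ^ 2
      ≤ ENNReal.ofReal C * ∫⁻ w, ‖normalizedKernel a w‖ₑ ^ 2 * ‖φ w‖ₑ ∂areaMeasure := by
    rw [enorm_sq_eq_lintegral _ (mulOperator_ae_eq φ hφ k),
      ← lintegral_const_mul' _ _ ENNReal.ofReal_ne_top]
    refine lintegral_mono_ae ?_
    filter_upwards [hkae, ae_areaMeasure_mem] with w hw hw1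
    have h2 : ‖φ w‖ₑ ≤ ENNReal.ofReal C := by
      rw [← ofReal_norm]
      exact ENNReal.ofReal_le_ofReal (hC w hw1)
    rw [hw, enorm_mul]
    calc (‖φ w‖ₑ * ‖normalizedKernel a w‖ₑ) ^ 2
        = ‖φ w‖ₑ * (‖normalizedKernel a w‖ₑ ^ 2 * ‖φ w‖ₑ) := by ring
      _ ≤ _ := by gcongr
  have hk1 : ‖k‖ ^ 2 = 1 := by
    rw [← ofReal_norm, ← ENNReal.ofReal_pow (norm_nonneg _)] at hnorm
    exact ENNReal.ofReal_eq_one.1 hnorm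
  have h3 : (1 : ℝ) ≤ N ^ 2 * ‖mulOperator φ hφ k‖ ^ 2 := by
    have h4 : ‖k‖ ≤ N * ‖toeplitz φ hφ K‖ := h K
    calc (1 : ℝ) = ‖k‖ ^ 2 := hk1.symm
      _ ≤ (N * ‖toeplitz φ hφ K‖) ^ 2 := by gcongr
      _ = N ^ 2 * ‖toeplitz φ hφ K‖ ^ 2 := mul_pow _ _ _
      _ ≤ _ := by gcongr
  calc (1 : ℝ≥0∞) = ENNReal.ofReal 1 := ENNReal.ofReal_one.symm
    _ ≤ ENNReal.ofReal (N ^ 2 * ‖mulOperator φ hφ k‖ ^ 2) := ENNReal.ofReal_le_ofReal h3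
    _ = ENNReal.ofReal (N ^ 2) * ‖mulOperator φ hφ k‖ₑ ^ 2 := by
        rw [ENNReal.ofReal_mul (by positivity), ENNReal.ofReal_pow (norm_nonneg _), ofReal_norm]
    _ ≤ _ := mul_le_mul' le_rfl hmul
    _ = _ := by rw [ENNReal.ofReal_mul (by positivity), mul_assoc]

/-! ### The Berezin transform as an element of `L^∞` -/

theorem berezin_norm_eq {φ : ℂ → ℂ} (hφ : AEMeasurable φ areaMeasure) (a : ℂ) :
    berezin (fun w => ((‖φ w‖ : ℝ) : ℂ)) a
      = (∫⁻ w, ‖normalizedKernel a w‖ₑ ^ 2 * ‖φ w‖ₑ ∂areaMeasure).toReal := by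
  simp_rw [berezin, ← Complex.ofReal_mul]
  rw [integral_complex_ofReal, integral_eq_lintegral_of_nonneg_ae]
  · congr 2
    refine lintegral_congr fun w => ?_
    rw [ENNReal.ofReal_mul (by positivity), ENNReal.ofReal_pow (norm_nonneg _), ofReal_norm,
      ofReal_norm]
  · exact ae_of_all _ fun w => by positivity
  · have := measurable_normalizedKernel a
    exact AEMeasurable.aestronglyMeasurable (by fun_prop)

/-- The integral does not see the change to a measurable representative of `φ`, which makes the
integrand jointly measurable. -/
theorem measurable_berezin_norm {φ : ℂ → ℂ} (hφ : AEMeasurable φ areaMeasure) :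
    Measurable (berezin fun w => ((‖φ w‖ : ℝ) : ℂ)) := by
  have h : (berezin fun w => ((‖φ w‖ : ℝ) : ℂ)) = fun a =>
      (((∫⁻ w, ‖normalizedKernel a w‖ₑ ^ 2 * ‖hφ.mk φ w‖ₑ ∂areaMeasure).toReal : ℝ) : ℂ) := by
    ext a
    rw [berezin_norm_eq hφ]
    congr 2
    refine lintegral_congr_ae ?_
    filter_upwards [hφ.ae_eq_mk] with w hw
    rw [← hw]
  rw [h]
  refine Complex.measurable_ofReal.comp (ENNReal.measurable_toReal.comp ?_)
  refine Measurable.lintegral_prod_right'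
    (f := fun p : ℂ × ℂ => ‖normalizedKernel p.1 p.2‖ₑ ^ 2 * ‖hφ.mk φ p.2‖ₑ) ?_
  exact (measurable_normalizedKernel_uncurry.enorm.pow_const 2).mul
    (hφ.measurable_mk.comp measurable_snd).enorm

theorem lintegral_normalizedKernel_mul_le {g : ℂ → ℝ≥0∞} {C : ℝ≥0∞}
    (hg : ∀ z ∈ ball (0 : ℂ) 1, g z ≤ C) {a : ℂ} (ha : ‖a‖ < 1) :
    ∫⁻ w, ‖normalizedKernel a w‖ₑ ^ 2 * g w ∂areaMeasure ≤ C := by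
  calc ∫⁻ w, ‖normalizedKernel a w‖ₑ ^ 2 * g w ∂areaMeasure
      ≤ ∫⁻ w, ‖normalizedKernel a w‖ₑ ^ 2 * C ∂areaMeasure := by
        refine lintegral_mono_ae ?_
        filter_upwards [ae_areaMeasure_mem] with w hw
        gcongr
        exact hg w hw
    _ = C := by
        rw [lintegral_mul_const _ ((measurable_normalizedKernel a).enorm.pow_const 2),
          lintegral_normalizedKernel ha, one_mul]

theorem isInvertibleInLinfty_iff {b : ℂ → ℂ} (hb : MemLp b ∞ areaMeasure) :
    IsInvertibleInLinfty b ↔ ∃ ε : ℝ, 0 < ε ∧ ∀ᵐ z ∂areaMeasure, ε ≤ ‖b z‖ := by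
  constructor
  · rintro ⟨-, h, hh, hbh⟩
    have hbound := ae_le_eLpNormEssSup (f := h) (μ := areaMeasure)
    have htop : eLpNormEssSup h areaMeasure ≠ ⊤ := by
      rw [← eLpNorm_exponent_top]; exact hh.eLpNorm_ne_top
    set H : ℝ := (eLpNormEssSup h areaMeasure).toReal + 1 with hH
    have hHpos : 0 < H := by positivity
    refine ⟨H⁻¹, by positivity, ?_⟩
    filter_upwards [hbh, hbound] with z hz hz2
    have h1 : ‖h z‖ ≤ H := by
      have := ENNReal.toReal_mono htop hz2
      rw [toReal_enorm] at this
      linarith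
    have h2 : ‖b z‖ * ‖h z‖ = 1 := by rw [← norm_mul, hz, norm_one]
    rw [inv_le_iff_one_le_mul₀ hHpos, ← h2]
    gcongr
  · rintro ⟨ε, hε, hbε⟩
    refine ⟨hb, fun z => (b z)⁻¹, ?_, ?_⟩
    · refine memLp_top_of_bound hb.1.aemeasurable.inv.aestronglyMeasurable ε⁻¹ ?_
      filter_upwards [hbε] with z hz
      rw [norm_inv]
      gcongr
    · filter_upwards [hbε] with z hz
      exact mul_inv_cancel₀ (norm_pos_iff.1 (hε.trans_le hz))

/-! ### Comparison of `|φ|` with `Re φ` -/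

/-- `|z|² = (Re z)² + |Im z|² ≤ (C + 1) Re z`, combined with `2δ|z| ≤ δ² + |z|²`. The additive term
is `δ/2` so that it uses up only half of a lower bound `δ`. -/
theorem norm_le_half_add_re {z : ℂ} {C δ : ℝ} (hz : |z.im| ^ 2 ≤ z.re) (hC : ‖z‖ ≤ C)
    (hδ : 0 < δ) : ‖z‖ ≤ δ / 2 + (C + 1) / (2 * δ) * z.re := by
  have h0 : 0 ≤ z.re := (sq_nonneg _).trans hz
  have h1 : ‖z‖ ^ 2 ≤ (C + 1) * z.re := by
    have h2 : ‖z‖ ^ 2 = z.re * z.re + |z.im| ^ 2 := by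
      rw [← Complex.normSq_eq_norm_sq, Complex.normSq_apply, sq_abs]; ring
    nlinarith [(Complex.re_le_norm z).trans hC]
  have h3 : 2 * δ * ‖z‖ ≤ δ ^ 2 + (C + 1) * z.re := by nlinarith [sq_nonneg (‖z‖ - δ)]
  rw [div_mul_eq_mul_div, div_add_div _ _ two_ne_zero (by positivity),
    le_div_iff₀ (by positivity)]
  nlinarith

/-- For symbols with `|Im φ|² ≤ Re φ`, a lower bound on the Berezin transform of `|φ|` gives one
on the Berezin transform of `Re φ`. -/
theorem le_lintegral_normalizedKernel_mul_re {φ : ℂ → ℂ}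
    (hre : ∀ z ∈ ball (0 : ℂ) 1, |(φ z).im| ^ 2 ≤ (φ z).re) {C δ : ℝ} (hC0 : 0 ≤ C)
    (hC : ∀ z ∈ ball (0 : ℂ) 1, ‖φ z‖ ≤ C) (hδ : 0 < δ) {a : ℂ} (ha : ‖a‖ < 1)
    (h : ENNReal.ofReal δ ≤ ∫⁻ w, ‖normalizedKernel a w‖ₑ ^ 2 * ‖φ w‖ₑ ∂areaMeasure) :
    ENNReal.ofReal (δ ^ 2 / (C + 1)) ≤
      ∫⁻ w, ‖normalizedKernel a w‖ₑ ^ 2 * ENNReal.ofReal (φ w).re ∂areaMeasure := by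
  set D : ℝ := (C + 1) / (2 * δ) with hD
  have hDpos : 0 < D := by positivity
  have hkm : Measurable fun w => ‖normalizedKernel a w‖ₑ ^ 2 :=
    (measurable_normalizedKernel a).enorm.pow_const 2
  set J := ∫⁻ w, ‖normalizedKernel a w‖ₑ ^ 2 * ENNReal.ofReal (φ w).re ∂areaMeasure with hJ
  have h1 : ENNReal.ofReal (δ / 2) + ENNReal.ofReal (δ / 2)
      ≤ ENNReal.ofReal (δ / 2) + ENNReal.ofReal D * J := by
    rw [← ENNReal.ofReal_add (by positivity) (by positivity), add_halves]
    refine h.trans ?_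
    calc ∫⁻ w, ‖normalizedKernel a w‖ₑ ^ 2 * ‖φ w‖ₑ ∂areaMeasure
        ≤ ∫⁻ w, (‖normalizedKernel a w‖ₑ ^ 2 * ENNReal.ofReal (δ / 2)
          + ENNReal.ofReal D * (‖normalizedKernel a w‖ₑ ^ 2 * ENNReal.ofReal (φ w).re))
            ∂areaMeasure := by
          refine lintegral_mono_ae ?_
          filter_upwards [ae_areaMeasure_mem] with w hw
          have h2 : ‖φ w‖ₑ ≤ ENNReal.ofReal (δ / 2)
              + ENNReal.ofReal D * ENNReal.ofReal (φ w).re := by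
            have h0 : 0 ≤ (φ w).re := (sq_nonneg _).trans (hre w hw)
            rw [← ofReal_norm, ← ENNReal.ofReal_mul hDpos.le,
              ← ENNReal.ofReal_add (by positivity) (by positivity)]
            exact ENNReal.ofReal_le_ofReal (norm_le_half_add_re (hre w hw) (hC w hw) hδ)
          rw [mul_left_comm, ← mul_add]
          gcongr
      _ = _ := by
          rw [lintegral_add_left (hkm.mul_const _), lintegral_mul_const _ hkm,
            lintegral_normalizedKernel ha, one_mul, lintegral_const_mul' _ _ ENNReal.ofReal_ne_top]
  have h2 := (ENNReal.add_le_add_iff_left ENNReal.ofReal_ne_top).1 h1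
  calc ENNReal.ofReal (δ ^ 2 / (C + 1)) = ENNReal.ofReal D⁻¹ * ENNReal.ofReal (δ / 2) := by
        rw [← ENNReal.ofReal_mul (by positivity), hD]
        congr 1
        field_simp
    _ ≤ ENNReal.ofReal D⁻¹ * (ENNReal.ofReal D * J) := mul_le_mul' le_rfl h2
    _ = J := by
        rw [← mul_assoc, ← ENNReal.ofReal_mul (by positivity), inv_mul_cancel₀ hDpos.ne',
          ENNReal.ofReal_one, one_mul]

end BergmanToeplitz

end

/-! ### The equivalence -/

open BergmanToeplitz MeasureTheory Metric in
theorem theorem3p1 (φ : ℂ → ℂ)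
    (hmeas : AEMeasurable φ BergmanToeplitz.areaMeasure)
    (hbdd : ∃ C : ℝ, ∀ z ∈ Metric.ball (0 : ℂ) 1, ‖φ z‖ ≤ C)
    (hre : ∀ z ∈ Metric.ball (0 : ℂ) 1, |(φ z).im| ^ 2 ≤ (φ z).re) :
    IsUnit (BergmanToeplitz.toeplitz φ (BergmanToeplitz.memLp_top_of_bounded hmeas hbdd)) ↔
      BergmanToeplitz.IsInvertibleInLinfty
        (BergmanToeplitz.berezin (fun w => ((‖φ w‖ : ℝ) : ℂ))) := by
  have hφ := memLp_top_of_bounded hmeas hbdd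
  obtain ⟨C, hC⟩ := hbdd
  have hC0 : 0 ≤ C := (norm_nonneg _).trans (hC 0 (by simp))
  have hCe : ∀ z ∈ ball (0 : ℂ) 1, ‖φ z‖ₑ ≤ ENNReal.ofReal C := fun z hz => by
    rw [← ofReal_norm]
    exact ENNReal.ofReal_le_ofReal (hC z hz)
  have hble : ∀ {a : ℂ}, ‖a‖ < 1 →
      ∫⁻ w, ‖normalizedKernel a w‖ₑ ^ 2 * ‖φ w‖ₑ ∂areaMeasure ≤ ENNReal.ofReal C :=
    fun ha => lintegral_normalizedKernel_mul_le hCe ha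
  have hbtop : ∀ {a : ℂ}, ‖a‖ < 1 →
      ∫⁻ w, ‖normalizedKernel a w‖ₑ ^ 2 * ‖φ w‖ₑ ∂areaMeasure ≠ ⊤ :=
    fun ha => ((hble ha).trans_lt ENNReal.ofReal_lt_top).ne
  have hbnorm : ∀ a, ‖berezin (fun w => ((‖φ w‖ : ℝ) : ℂ)) a‖
      = (∫⁻ w, ‖normalizedKernel a w‖ₑ ^ 2 * ‖φ w‖ₑ ∂areaMeasure).toReal := fun a => by
    rw [berezin_norm_eq hmeas, Complex.norm_real, Real.norm_of_nonneg ENNReal.toReal_nonneg]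
  have hbmem : MemLp (berezin fun w => ((‖φ w‖ : ℝ) : ℂ)) ⊤ areaMeasure := by
    refine memLp_top_of_bounded (measurable_berezin_norm hmeas).aemeasurable ⟨C, fun a ha => ?_⟩
    rw [hbnorm]
    exact ENNReal.toReal_le_of_le_ofReal hC0 (hble (mem_ball_zero_iff.1 ha))
  rw [isInvertibleInLinfty_iff hbmem]
  constructor
  · rintro ⟨u, hu⟩
    set N : ℝ := ‖(↑u⁻¹ : bergmanSpace →L[ℂ] bergmanSpace)‖ + 1 with hN
    have hbelow : ∀ F : bergmanSpace, ‖F‖ ≤ N * ‖toeplitz φ hφ F‖ := by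
      intro F
      have h1 : (↑u⁻¹ : bergmanSpace →L[ℂ] bergmanSpace) (toeplitz φ hφ F) = F := by
        rw [← hu, ← mul_apply_eq_comp, Units.inv_mul, one_apply_eq_self]
      calc ‖F‖ = ‖(↑u⁻¹ : bergmanSpace →L[ℂ] bergmanSpace) (toeplitz φ hφ F)‖ := by rw [h1]
        _ ≤ ‖(↑u⁻¹ : bergmanSpace →L[ℂ] bergmanSpace)‖ * ‖toeplitz φ hφ F‖ :=
          ContinuousLinearMap.le_opNorm _ _
        _ ≤ _ := by gcongr; linarith
    have hNpos : 0 < N := by positivity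
    refine ⟨(N ^ 2 * (C + 1))⁻¹, by positivity, ?_⟩
    filter_upwards [ae_areaMeasure_mem] with a ha
    rw [mem_ball_zero_iff] at ha
    -- `C + 1` in place of `C` keeps the constant positive when `C = 0`.
    have h2 := one_le_of_norm_le_toeplitz hφ (C := C + 1)
      (fun z hz => (hC z hz).trans (by linarith)) hbelow ha
    have h3 := ENNReal.toReal_mono (ENNReal.mul_ne_top ENNReal.ofReal_ne_top (hbtop ha)) h2
    rw [ENNReal.toReal_one, ENNReal.toReal_mul, ENNReal.toReal_ofReal (by positivity),
      ← hbnorm] at h3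
    rwa [inv_le_iff_one_le_mul₀' (by positivity)]
  · rintro ⟨δ, hδ, hb⟩
    have hre0 : ∀ z ∈ ball (0 : ℂ) 1, 0 ≤ (φ z).re := fun z hz =>
      (sq_nonneg _).trans (hre z hz)
    have hB : ∀ᵐ a ∂areaMeasure, ENNReal.ofReal (δ ^ 2 / (C + 1)) ≤
        ∫⁻ w, ‖normalizedKernel a w‖ₑ ^ 2 * ENNReal.ofReal (φ w).re ∂areaMeasure := by
      filter_upwards [hb, ae_areaMeasure_mem] with a hba ha
      rw [mem_ball_zero_iff] at ha
      rw [hbnorm] at hba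
      exact le_lintegral_normalizedKernel_mul_re hre hC0 hC hδ ha
        (ENNReal.ofReal_le_of_le_toReal hba)
    obtain ⟨N, hN, h⟩ := exists_lintegral_enorm_sq_le (C := C) (by positivity)
      (g := fun w => ENNReal.ofReal (φ w).re) (by fun_prop)
      (fun w hw => ENNReal.ofReal_le_ofReal ((Complex.re_le_norm _).trans (hC w hw))) hB
    exact isUnit_toeplitz_of_lintegral_le hφ hre0 hN h
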